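/- Let $k$ be a non-negative integer. 1. There exist $x,y,z\in\mathbb{Z}$ with $k=x^2+y^2+2z^2$ if and only if $2k$ is not of the form $4^m(8l+7)$ with integers $m,l\ge 0$. 2. Let $N_{1,1,2}(k)$ be the number of triples $(x,y,z)\in\mathbb{Z}^3$ with $k=x^2+y^2+2z^2$, and let $N_3(2k)$ be the number of triples $(x,y,z)\in\mathbb{Z}^3$ with $2k=x^2+y^2+z^2$. Both numbers are finite, and $N_{1,1,2}(k)=N_3(2k)$ if $k$ is even, while $N_{1,1,2}(k)=N_3(2k)/3$ if $k$ is odd. -/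

import Mathlib

/-- The presentations of `k` in the form `k = x² + y² + z²` with integers `x, y, z`
(ordered triples, signs distinguished). -/
def reps3 (k : ℕ) : Set (ℤ × ℤ × ℤ) :=
  {p | (k : ℤ) = p.1 ^ 2 + p.2.1 ^ 2 + p.2.2 ^ 2}

/-- The presentations of `k` in the form `k = x² + y² + 2z²` with integers `x, y, z`
(ordered triples, signs distinguished). -/
def reps112 (k : ℕ) : Set (ℤ × ℤ × ℤ) :=
  {p | (k : ℤ) = p.1 ^ 2 + p.2.1 ^ 2 + 2 * p.2.2 ^ 2}

/-- The number of presentations of `k` as a sum of three integer squares. -/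
noncomputable def N3 (k : ℕ) : ℕ := (reps3 k).ncard

/-- The number of presentations of `k` in the form `x² + y² + 2z²`. -/
noncomputable def N112 (k : ℕ) : ℕ := (reps112 k).ncard

/-! The map `doubling` is a bijection from solutions of `k = x² + y² + 2z²` to solutions of `2k = x²
+ y² + z²` with even last coordinate. Reducing mod 4, all coordinates are even when `k` is even, and
exactly one is when `k` is odd; symmetry then gives the factor 3.

Existence thus reduces to Legendre's theorem. By Minkowski, a positive definite integral ternary
form of determinant one takes the value 1. Splitting off such a vector leaves a binary part whose
values are sums of two squares (`ternaryForm_eq_sum_three_sq`). Dirichlet's theorem and quadratic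
reciprocity produce such a form representing `n`. -/

/-- **Minkowski's theorem** for a unimodular image of `ℤ³` and the ball of radius `√2`. -/
theorem exists_int_vec_sum_sq_mulVec_lt_two (L : Matrix (Fin 3) (Fin 3) ℝ) (hL : L.det = 1) :
    ∃ v : Fin 3 → ℤ, v ≠ 0 ∧ ∑ i, (L.mulVec (fun j => (v j : ℝ)) i) ^ 2 < 2 := by
  let b := Pi.basisFun ℝ (Fin 3)
  let g : (Fin 3 → ℝ) →ₗ[ℝ] EuclideanSpace ℝ (Fin 3) :=
    (WithLp.linearEquiv 2 ℝ (Fin 3 → ℝ)).symm.toLinearMap ∘ₗ Matrix.toLin' L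
  let s : Set (Fin 3 → ℝ) := g ⁻¹' Metric.ball 0 (√2)
  have hs : ∀ x, x ∈ s ↔ ∑ i, (L.mulVec x i) ^ 2 < 2 := by
    intro x
    have : g x = WithLp.toLp 2 (L.mulVec x) := rfl
    rw [Set.mem_preimage, mem_ball_zero_iff, EuclideanSpace.norm_eq, this]
    rw [Real.sqrt_lt_sqrt_iff (by positivity)]
    simp
  have hvol : MeasureTheory.volume s = .ofReal (√2) ^ 3 * .ofReal (Real.pi * 4 / 3) := by
    have h1 : s = Matrix.toLin' L ⁻¹' (WithLp.toLp 2 ⁻¹' Metric.ball 0 (√2)) := rfl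
    rw [h1, MeasureTheory.Measure.addHaar_preimage_linearMap]
    · rw [(PiLp.volume_preserving_toLp (Fin 3)).measure_preimage
        measurableSet_ball.nullMeasurableSet, EuclideanSpace.volume_ball_fin_three]
      simp [LinearMap.det_toLin', hL]
    · simp [LinearMap.det_toLin', hL]
  have hfund := ZSpan.isAddFundamentalDomain' b MeasureTheory.volume
  have : Countable (Submodule.span ℤ (Set.range b)).toAddSubgroup :=
    inferInstanceAs (Countable (Submodule.span ℤ (Set.range b)))
  obtain ⟨x, hx0, hxs⟩ :=
    MeasureTheory.exists_ne_zero_mem_lattice_of_measure_mul_two_pow_lt_measure hfund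
      (s := s) (fun x hx => by
        rw [hs] at hx ⊢
        simpa [Matrix.mulVec_neg] using hx)
      ((convex_ball _ _).linear_preimage g) (by
        rw [hvol, ZSpan.volume_fundamentalDomain]
        have : Matrix.of b = 1 := by
          ext i j
          simp [b, Matrix.one_apply, Pi.single_apply, eq_comm]
        rw [this, ← ENNReal.ofReal_pow (by positivity), ← ENNReal.ofReal_mul (by positivity)]
        -- The ball has volume `8√2π/3`; exceeding `2³` means `√2 * π > 3`.
        have h2 : (√2 : ℝ) ^ 3 = 2 * √2 := by
          rw [pow_succ, Real.sq_sqrt (by norm_num)]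
        have h3 : (1.4 : ℝ) < √2 := by
          rw [Real.lt_sqrt (by norm_num)]; norm_num
        have h4 := Real.pi_gt_three
        simp only [Matrix.det_one, abs_one, ENNReal.ofReal_one, one_mul,
          Module.finrank_fintype_fun_eq_card, Fintype.card_fin]
        rw [h2, show (2 : ENNReal) ^ 3 = ENNReal.ofReal 8 by norm_num]
        rw [ENNReal.ofReal_lt_ofReal_iff (by positivity)]
        nlinarith)
  have hxm := x.2
  rw [Submodule.mem_toAddSubgroup, Module.Basis.mem_span_iff_repr_mem ℤ b] at hxm
  choose v hv using hxm
  have hv' : (fun j => (v j : ℝ)) = (x : Fin 3 → ℝ) := by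
    ext j
    simpa [b] using hv j
  refine ⟨v, ?_, ?_⟩
  · rintro rfl
    apply hx0
    ext j
    simp [← hv']
  · rw [hv']
    exact (hs _).1 hxs

/-! ### Positive definite ternary forms of determinant one -/

/-- The integral ternary quadratic form with symmetric matrix `!![a, f, e; f, b, d; e, d, c]`. -/
def ternaryForm (a b c d e f x y z : ℤ) : ℤ :=
  a * x ^ 2 + b * y ^ 2 + c * z ^ 2 + 2 * (d * y * z + e * x * z + f * x * y)

section Ternary

variable {a b c d e f : ℤ}

theorem ternaryForm_complete_squares
    (hdet : a * b * c + 2 * d * e * f - a * d ^ 2 - b * e ^ 2 - c * f ^ 2 = 1) (x y z : ℤ) :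
    a * (a * b - f ^ 2) * ternaryForm a b c d e f x y z =
      (a * b - f ^ 2) * (a * x + f * y + e * z) ^ 2 +
        ((a * b - f ^ 2) * y + (a * d - e * f) * z) ^ 2 + a * z ^ 2 := by
  unfold ternaryForm
  linear_combination a * z ^ 2 * hdet

theorem ternaryForm_pos (ha : 0 < a) (hD : 0 < a * b - f ^ 2)
    (hdet : a * b * c + 2 * d * e * f - a * d ^ 2 - b * e ^ 2 - c * f ^ 2 = 1) {x y z : ℤ}
    (h : ¬ (x = 0 ∧ y = 0 ∧ z = 0)) : 0 < ternaryForm a b c d e f x y z := by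
  have key := ternaryForm_complete_squares hdet x y z
  by_contra hQ
  have haD : 0 < a * (a * b - f ^ 2) := mul_pos ha hD
  have h0 : a * (a * b - f ^ 2) * ternaryForm a b c d e f x y z ≤ 0 :=
    mul_nonpos_of_nonneg_of_nonpos haD.le (not_lt.1 hQ)
  have h1 : 0 ≤ (a * b - f ^ 2) * (a * x + f * y + e * z) ^ 2 := by positivity
  have h2 : 0 ≤ ((a * b - f ^ 2) * y + (a * d - e * f) * z) ^ 2 := by positivity
  have h3 : 0 ≤ a * z ^ 2 := by positivity
  have hz : z = 0 := by
    have : a * z ^ 2 = 0 := by linarith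
    simpa [ha.ne'] using this
  have hy : y = 0 := by
    have : ((a * b - f ^ 2) * y + (a * d - e * f) * z) ^ 2 = 0 := by linarith
    simpa [hz, hD.ne'] using this
  have hx : x = 0 := by
    have : (a * b - f ^ 2) * (a * x + f * y + e * z) ^ 2 = 0 := by linarith
    simpa [hz, hy, hD.ne', ha.ne'] using this
  exact h ⟨hx, hy, hz⟩

theorem exists_ternaryForm_eq_one (ha : 0 < a) (hD : 0 < a * b - f ^ 2)
    (hdet : a * b * c + 2 * d * e * f - a * d ^ 2 - b * e ^ 2 - c * f ^ 2 = 1) :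
    ∃ x y z : ℤ, ternaryForm a b c d e f x y z = 1 := by
  set D := a * b - f ^ 2 with hDdef
  have ha' : (0 : ℝ) < a := by exact_mod_cast ha
  have hD' : (0 : ℝ) < D := by exact_mod_cast hD
  have hsa := Real.sq_sqrt ha'.le
  have hsD := Real.sq_sqrt hD'.le
  have hsa0 := Real.sqrt_pos.2 ha'
  have hsD0 := Real.sqrt_pos.2 hD'
  -- Completing squares gives `Q(v) = |Lv|²` with `L` upper triangular of determinant one.
  let L : Matrix (Fin 3) (Fin 3) ℝ :=
    !![a / √a, f / √a, e / √a; 0, D / (√a * √D), (a * d - e * f) / (√a * √D); 0, 0, 1 / √D]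
  have hL : L.det = 1 := by
    have : L.det = a / √a * (D / (√a * √D)) * (1 / √D) := by
      simp [L, Matrix.det_fin_three]
    rw [this]
    field_simp
    rw [hsa, hsD]
  obtain ⟨v, hv0, hv⟩ := exists_int_vec_sum_sq_mulVec_lt_two L hL
  have hlt : ternaryForm a b c d e f (v 0) (v 1) (v 2) < 2 := by
    have key := ternaryForm_complete_squares hdet (v 0) (v 1) (v 2)
    rw [← hDdef] at key
    replace key := congrArg (Int.cast : ℤ → ℝ) key
    push_cast at key
    have hsum : ∑ i, (L.mulVec (fun j => (v j : ℝ)) i) ^ 2 =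
        ternaryForm a b c d e f (v 0) (v 1) (v 2) := by
      apply mul_left_cancel₀ (mul_pos ha' hD').ne'
      rw [key]
      simp only [Fin.sum_univ_three, L, Matrix.mulVec, dotProduct, Matrix.of_apply,
        Matrix.cons_val', Matrix.cons_val_zero, Matrix.cons_val_one, Matrix.cons_val]
      field_simp
      rw [hsa, hsD]
      ring
    rw [hsum] at hv
    exact_mod_cast hv
  have hpos : 0 < ternaryForm a b c d e f (v 0) (v 1) (v 2) := by
    refine ternaryForm_pos ha hD hdet fun h => hv0 ?_
    ext i
    fin_cases i
    exacts [h.1, h.2.1, h.2.2]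
  exact ⟨v 0, v 1, v 2, by omega⟩

theorem Int.exists_primitive_factorization {x y z : ℤ} (h : ¬ (x = 0 ∧ y = 0 ∧ z = 0)) :
    ∃ g x' y' z' r s t : ℤ, x = g * x' ∧ y = g * y' ∧ z = g * z' ∧
      r * x' + s * y' + t * z' = 1 := by
  let g : ℤ := Int.gcd x (Int.gcd y z)
  have hg : g ≠ 0 := by
    simp only [g, ne_eq, Nat.cast_eq_zero, Int.gcd_eq_zero_iff, not_and]
    tauto
  have hx : g ∣ x := Int.gcd_dvd_left ..
  have hyz : g ∣ (Int.gcd y z : ℤ) := Int.gcd_dvd_right ..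
  obtain ⟨x', hx'⟩ := hx
  obtain ⟨y', hy'⟩ := hyz.trans (Int.gcd_dvd_left ..)
  obtain ⟨z', hz'⟩ := hyz.trans (Int.gcd_dvd_right ..)
  have h1 : g = x * _ + _ * _ := Int.gcd_eq_gcd_ab x (Int.gcd y z)
  have h2 := Int.gcd_eq_gcd_ab y z
  refine ⟨g, x', y', z', Int.gcdA x (Int.gcd y z),
    Int.gcdA y z * Int.gcdB x (Int.gcd y z), Int.gcdB y z * Int.gcdB x (Int.gcd y z),
    hx', hy', hz', ?_⟩
  apply mul_left_cancel₀ hg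
  generalize Int.gcdA x (Int.gcd y z) = A at *
  generalize Int.gcdB x (Int.gcd y z) = B at *
  linear_combination (-A) * hx' - B * Int.gcdA y z * hy' - B * Int.gcdB y z * hz' - h1 - B * h2

/-- Let `A` be the Gram matrix, `v = (p, q, r)` and `u = Av`. A primitive `x ⊥ u` admits an integral
`w` with `x × w = u`. Then `Q(x)Q(w) - B(x, w)² = uᵀ adj(A) u = Q(v) = 1`, so `-1` is a square mod
`Q(x)`. -/
theorem ternaryForm_eq_sq_add_sq (ha : 0 < a) (hD : 0 < a * b - f ^ 2)
    (hdet : a * b * c + 2 * d * e * f - a * d ^ 2 - b * e ^ 2 - c * f ^ 2 = 1)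
    {p q r x y z : ℤ} (hv : ternaryForm a b c d e f p q r = 1)
    (horth : (a * p + f * q + e * r) * x + (f * p + b * q + d * r) * y +
      (e * p + d * q + c * r) * z = 0) :
    ∃ s t : ℤ, ternaryForm a b c d e f x y z = s ^ 2 + t ^ 2 := by
  by_cases h0 : x = 0 ∧ y = 0 ∧ z = 0
  · obtain ⟨rfl, rfl, rfl⟩ := h0
    exact ⟨0, 0, by simp [ternaryForm]⟩
  obtain ⟨g, x, y, z, r₁, r₂, r₃, rfl, rfl, rfl, hr⟩ := Int.exists_primitive_factorization h0
  have hg : g ≠ 0 := by rintro rfl; simp at h0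
  have h0' : ¬ (x = 0 ∧ y = 0 ∧ z = 0) := by
    rintro ⟨rfl, rfl, rfl⟩; simp at h0
  set u₁ := a * p + f * q + e * r with hu₁
  set u₂ := f * p + b * q + d * r with hu₂
  set u₃ := e * p + d * q + c * r with hu₃
  replace horth : u₁ * x + u₂ * y + u₃ * z = 0 :=
    mul_left_cancel₀ hg (by linear_combination horth)
  set w₁ := u₂ * r₃ - u₃ * r₂ with hw₁
  set w₂ := u₃ * r₁ - u₁ * r₃ with hw₂
  set w₃ := u₁ * r₂ - u₂ * r₁ with hw₃
  set B := a * x * w₁ + b * y * w₂ + c * z * w₃ + d * (y * w₃ + z * w₂) +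
    e * (x * w₃ + z * w₁) + f * (x * w₂ + y * w₁) with hB
  have hc₁ : y * w₃ - z * w₂ = u₁ := by
    linear_combination u₁ * hr - r₁ * horth
  have hc₂ : z * w₁ - x * w₃ = u₂ := by
    linear_combination u₂ * hr - r₂ * horth
  have hc₃ : x * w₂ - y * w₁ = u₃ := by
    linear_combination u₃ * hr - r₃ * horth
  have hadj : (b * c - d ^ 2) * u₁ ^ 2 + (a * c - e ^ 2) * u₂ ^ 2 + (a * b - f ^ 2) * u₃ ^ 2 +
      2 * ((e * f - a * d) * u₂ * u₃ + (d * f - b * e) * u₁ * u₃ + (d * e - c * f) * u₁ * u₂)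
      = 1 := by
    rw [hu₁, hu₂, hu₃]
    unfold ternaryForm at hv
    linear_combination hv + (a * p ^ 2 + b * q ^ 2 + c * r ^ 2 +
      2 * (d * q * r + e * p * r + f * p * q)) * hdet
  have hQ : ternaryForm a b c d e f x y z * ternaryForm a b c d e f w₁ w₂ w₃ - B ^ 2 = 1 := by
    rw [← hadj, ← hc₁, ← hc₂, ← hc₃, hB]
    clear_value w₁ w₂ w₃
    unfold ternaryForm
    ring
  have hpos := ternaryForm_pos ha hD hdet h0'
  obtain ⟨N, hN⟩ := Int.eq_ofNat_of_zero_le hpos.le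
  have hsq : IsSquare (-1 : ZMod N) := by
    refine ⟨(B : ZMod N), ?_⟩
    have := congrArg (Int.cast : ℤ → ZMod N) hQ
    rw [hN] at this
    push_cast at this
    rw [ZMod.natCast_self] at this
    linear_combination this
  obtain ⟨s, t, hst⟩ := Nat.eq_sq_add_sq_of_isSquare_mod_neg_one hsq
  refine ⟨g * s, g * t, ?_⟩
  have : (N : ℤ) = s ^ 2 + t ^ 2 := by exact_mod_cast hst
  rw [this] at hN
  unfold ternaryForm at hN ⊢
  linear_combination g ^ 2 * hN

/-- A positive definite integral ternary form of determinant one represents only sums of three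
squares. -/
theorem ternaryForm_eq_sum_three_sq (ha : 0 < a) (hD : 0 < a * b - f ^ 2)
    (hdet : a * b * c + 2 * d * e * f - a * d ^ 2 - b * e ^ 2 - c * f ^ 2 = 1) (x y z : ℤ) :
    ∃ r s t : ℤ, ternaryForm a b c d e f x y z = r ^ 2 + s ^ 2 + t ^ 2 := by
  obtain ⟨p, q, r, hv⟩ := exists_ternaryForm_eq_one ha hD hdet
  -- `T` is the pairing with `v = (p, q, r)`; as `Q(v) = 1`, subtracting `T • v` is an integral
  -- orthogonal projection.
  let T := (a * p + f * q + e * r) * x + (f * p + b * q + d * r) * y + (e * p + d * q + c * r) * z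
  have hv' := hv
  unfold ternaryForm at hv'
  obtain ⟨s, t, hst⟩ := ternaryForm_eq_sq_add_sq ha hD hdet (x := x - T * p) (y := y - T * q)
    (z := z - T * r) hv (by linear_combination (-T) * hv')
  refine ⟨T, s, t, ?_⟩
  unfold ternaryForm at hst ⊢
  linear_combination hst + (-T ^ 2) * hv'

end Ternary

/-! ### Legendre's three-square theorem -/

/-- The divisibility supplies the entry `a` making the determinant one, with leading minors `d * n -
1` and `d`; the form takes the value `n` at `(0, 0, 1)`. -/
theorem sum_three_sq_of_dvd_sq_add {n d b : ℤ} (hd : 0 < d) (hM : 0 < d * n - 1)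
    (h : d * n - 1 ∣ b ^ 2 + d) : ∃ x y z : ℤ, n = x ^ 2 + y ^ 2 + z ^ 2 := by
  obtain ⟨a, ha⟩ := h
  obtain ⟨x, y, z, h⟩ := ternaryForm_eq_sum_three_sq (a := d * n - 1) (b := a) (c := n) (d := 1)
    (e := 0) (f := b) hM (by linarith) (by linear_combination (-n) * ha) 0 0 1
  exact ⟨x, y, z, by simpa [ternaryForm] using h⟩

theorem exists_dvd_sq_add_of_jacobiSym_neg {p d : ℕ} (hp : p.Prime)
    (h : jacobiSym (-d) p = 1) : ∃ b : ℤ, (p : ℤ) ∣ b ^ 2 + d := by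
  have := Fact.mk hp
  obtain ⟨b, hb⟩ := ZMod.isSquare_of_jacobiSym_eq_one h
  refine ⟨b.val, ?_⟩
  rw [← ZMod.intCast_zmod_eq_zero_iff_dvd]
  push_cast at hb ⊢
  rw [ZMod.natCast_zmod_val]
  linear_combination -hb

/-- Choose a prime `p = d * n - 1` with `d ≡ 1` mod 4; then `(-d/p) = (p/d) = (-1/d) = 1`. -/
theorem sum_three_sq_of_mod_four_eq_two {n : ℕ} (hn : n % 4 = 2) :
    ∃ x y z : ℤ, (n : ℤ) = x ^ 2 + y ^ 2 + z ^ 2 := by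
  have hcop : (n - 1).Coprime (4 * n) := by
    apply Nat.Coprime.mul_right
    · have : Nat.Coprime (n - 1) 2 := Nat.coprime_two_right.2 (Nat.odd_iff.2 (by omega))
      exact this.pow_right 2
    · have := Nat.coprime_self_sub_left (m := 1) (n := n) (by omega)
      simpa using this
  obtain ⟨p, hpn, hp, hmod⟩ := Nat.forall_exists_prime_gt_and_modEq n (by omega) hcop
  obtain ⟨j, hj⟩ := (Nat.modEq_iff_dvd' (by omega)).1 hmod.symm
  have hpj : p + 1 = (4 * j + 1) * n := by
    zify [show n - 1 ≤ p by omega, show 1 ≤ n by omega] at hj ⊢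
    linear_combination hj
  have hp4 : p % 4 = 1 := by
    have := congrArg (· % 4) hpj
    simp [Nat.mul_mod, Nat.add_mod, hn] at this
    omega
  set d := 4 * j + 1 with hd
  have hdo : Odd d := ⟨2 * j, by omega⟩
  have hpo : Odd p := Nat.odd_iff.2 (by omega)
  have hM : (d : ℤ) * n - 1 = p := by
    have : ((p + 1 : ℕ) : ℤ) = (d * n : ℕ) := by rw [hpj]
    push_cast at this; linarith
  have hmod' : (p : ℤ) % d = -1 % d :=
    Int.modEq_iff_dvd.2 ⟨-n, by linear_combination hM⟩
  have hJ : jacobiSym (-d) p = 1 := by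
    rw [jacobiSym.neg _ hpo, ZMod.χ₄_nat_one_mod_four hp4, one_mul,
      jacobiSym.quadratic_reciprocity_one_mod_four (by omega) hpo,
      jacobiSym.mod_left' hmod', jacobiSym.at_neg_one hdo,
      ZMod.χ₄_nat_one_mod_four (by omega)]
  obtain ⟨b, hb⟩ := exists_dvd_sq_add_of_jacobiSym_neg hp hJ
  exact sum_three_sq_of_dvd_sq_add (d := d) (b := b) (by omega)
    (by rw [hM]; exact_mod_cast hp.pos) (by rwa [hM])

/-- Choose a prime `p` with `2p = d * n - 1` and `(-2/d) = 1`; then `(-d/p) = (p/d) = (-2p/d) =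
(1/d) = 1`. -/
theorem sum_three_sq_of_odd {n : ℕ} (hn : n % 2 = 1) (hn7 : n % 8 ≠ 7) :
    ∃ x y z : ℤ, (n : ℤ) = x ^ 2 + y ^ 2 + z ^ 2 := by
  -- `c` is the residue of `d` mod 8 and `m` that of `p` mod `4n`. The last condition makes the
  -- reciprocity signs cancel.
  obtain ⟨c, m, hc, hcn, hmo, hcp, hc4⟩ : ∃ c m : ℕ, (c % 8 = 1 ∨ c % 8 = 3) ∧ 2 * m + 1 = c * n ∧
      m % 2 = 1 ∧ c < 8 ∧ (m % 4 = 1 ∨ c % 4 = 3) := by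
    by_cases h : n % 8 = 3
    · exact ⟨1, (n - 1) / 2, by omega⟩
    · exact ⟨3, (3 * n - 1) / 2, by omega⟩
  have hcop : m.Coprime (4 * n) := by
    apply Nat.Coprime.mul_right
    · have : Nat.Coprime m 2 := Nat.coprime_two_right.2 (Nat.odd_iff.2 hmo)
      exact this.pow_right 2
    · refine Nat.Coprime.coprime_dvd_right (Dvd.intro_left c hcn.symm) ?_
      simp
  obtain ⟨p, hpn, hp, hmod⟩ := Nat.forall_exists_prime_gt_and_modEq m (by omega) hcop
  obtain ⟨j, hj⟩ := (Nat.modEq_iff_dvd' (by omega)).1 hmod.symm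
  have hpj : 2 * p + 1 = (8 * j + c) * n := by
    zify [show m ≤ p by omega] at hj hcn ⊢
    linear_combination 2 * hj + hcn
  have hp4 : p % 4 = m % 4 := by
    have : p = m + 4 * (n * j) := by rw [← mul_assoc, ← hj]; omega
    omega
  set d := 8 * j + c with hd
  have hdo : Odd d := Nat.odd_iff.2 (by omega)
  have hpo : Odd p := Nat.odd_iff.2 (by omega)
  have hM : (d : ℤ) * n - 1 = 2 * p := by
    have : ((2 * p + 1 : ℕ) : ℤ) = (d * n : ℕ) := by rw [hpj]
    push_cast at this; linarith
  have h1 : jacobiSym (-d) p = jacobiSym p d := by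
    rw [jacobiSym.neg _ hpo]
    rcases Nat.odd_mod_four_iff.1 (Nat.odd_iff.1 hpo) with h | h
    · rw [ZMod.χ₄_nat_one_mod_four h, one_mul,
        jacobiSym.quadratic_reciprocity_one_mod_four' hdo h]
    · rw [ZMod.χ₄_nat_three_mod_four h,
        jacobiSym.quadratic_reciprocity_three_mod_four (by omega) h]
      ring
  have h2 : jacobiSym (-2) d = 1 := by
    rw [jacobiSym.at_neg_two hdo, ZMod.χ₈'_nat_eq_if_mod_eight]
    have : d % 8 = 1 ∨ d % 8 = 3 := by omega
    have h' : d % 2 ≠ 0 := by omega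
    simp [h', this]
  have hmod' : (-2 * p : ℤ) % d = 1 % d :=
    Int.modEq_iff_dvd.2 ⟨n, by linear_combination -hM⟩
  have hJ : jacobiSym (-d) p = 1 := by
    rw [h1, ← one_mul (jacobiSym p d)]
    nth_rewrite 1 [← h2]
    rw [← jacobiSym.mul_left, jacobiSym.mod_left' hmod', jacobiSym.one_left]
  obtain ⟨b, hb⟩ := exists_dvd_sq_add_of_jacobiSym_neg hp hJ
  -- With `b'` odd, 2 also divides `b'² + d`.
  obtain ⟨b', hb', hb'o⟩ : ∃ b' : ℤ, (p : ℤ) ∣ b' ^ 2 + d ∧ Odd b' := by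
    rcases Int.even_or_odd b with h | h
    · refine ⟨b + p, ?_, h.add_odd (by exact_mod_cast hpo)⟩
      have : (b + p) ^ 2 + d = (b ^ 2 + d) + p * (2 * b + p) := by ring
      rw [this]
      exact dvd_add hb (dvd_mul_right _ _)
    · exact ⟨b, hb, h⟩
  refine sum_three_sq_of_dvd_sq_add (d := d) (b := b') (by omega)
    (by rw [hM]; have := hp.pos; omega) ?_
  rw [hM]
  refine IsCoprime.mul_dvd ?_ ?_ hb'
  · rw [show (2 : ℤ) = ((2 : ℕ) : ℤ) by rfl, Nat.isCoprime_iff_coprime]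
    exact Nat.coprime_two_left.2 hpo
  · have : Odd (d : ℤ) := by exact_mod_cast hdo
    exact (hb'o.pow.add_odd this).two_dvd

theorem sum_three_sq_of_not_four_pow_mul {n : ℕ} (h : ¬ ∃ m l : ℕ, n = 4 ^ m * (8 * l + 7)) :
    ∃ x y z : ℤ, (n : ℤ) = x ^ 2 + y ^ 2 + z ^ 2 := by
  induction n using Nat.strong_induction_on with
  | _ n ih =>
    rcases Nat.eq_zero_or_pos n with rfl | hpos
    · exact ⟨0, 0, 0, by simp⟩
    by_cases h4 : n % 4 = 0
    · obtain ⟨t, rfl⟩ := Nat.dvd_of_mod_eq_zero h4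
      obtain ⟨x, y, z, hxyz⟩ := ih t (by omega) (by
        rintro ⟨m, l, rfl⟩
        exact h ⟨m + 1, l, by ring⟩)
      exact ⟨2 * x, 2 * y, 2 * z, by push_cast; rw [hxyz]; ring⟩
    by_cases h2 : n % 4 = 2
    · exact sum_three_sq_of_mod_four_eq_two h2
    · exact sum_three_sq_of_odd (by omega) fun h7 => h ⟨0, n / 8, by omega⟩

/-- Squares are 0, 1 or 4 mod 8, so three never sum to 7; a sum divisible by 4 has all terms even,
which permits descent. -/
theorem not_four_pow_mul_of_sum_three_sq {n : ℕ} {x y z : ℤ}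
    (h : (n : ℤ) = x ^ 2 + y ^ 2 + z ^ 2) : ¬ ∃ m l : ℕ, n = 4 ^ m * (8 * l + 7) := by
  rintro ⟨m, l, rfl⟩
  induction m generalizing x y z with
  | zero =>
    have h8 : ∀ t : ℤ, t ^ 2 % 8 = 0 ∨ t ^ 2 % 8 = 1 ∨ t ^ 2 % 8 = 4 := fun t => by
      have := Int.emod_nonneg t (show (8 : ℤ) ≠ 0 by norm_num)
      have := Int.emod_lt_of_pos t (show (0 : ℤ) < 8 by norm_num)
      rw [pow_two, Int.mul_emod]
      interval_cases t % 8 <;> simp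
    have := h8 x
    have := h8 y
    have := h8 z
    push_cast at h
    omega
  | succ m ih =>
    have h4 : ∀ t : ℤ, t % 2 = 0 ∧ t ^ 2 % 4 = 0 ∨ t ^ 2 % 4 = 1 := fun t => by
      rcases Int.even_or_odd' t with ⟨s, rfl | rfl⟩
      · left; ring_nf; omega
      · right; ring_nf; omega
    have hd : (x ^ 2 + y ^ 2 + z ^ 2) % 4 = 0 := by
      rw [← h]; push_cast; rw [pow_succ]; rw [mul_right_comm]; simp
    have := h4 x
    have := h4 y
    have := h4 z
    obtain ⟨x, rfl⟩ : (2 : ℤ) ∣ x := by omega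
    obtain ⟨y, rfl⟩ : (2 : ℤ) ∣ y := by omega
    obtain ⟨z, rfl⟩ : (2 : ℤ) ∣ z := by omega
    refine ih (x := x) (y := y) (z := z) ?_
    push_cast [pow_succ] at h ⊢
    linarith

/-- **Legendre's three-square theorem.** -/
theorem sum_three_sq_iff (n : ℕ) : (∃ x y z : ℤ, (n : ℤ) = x ^ 2 + y ^ 2 + z ^ 2) ↔
    ¬ ∃ m l : ℕ, n = 4 ^ m * (8 * l + 7) :=
  ⟨fun ⟨_, _, _, h⟩ => not_four_pow_mul_of_sum_three_sq h, sum_three_sq_of_not_four_pow_mul⟩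

/-! ### Comparison of `x² + y² + 2z²` with three squares -/

/-- The injection `(x, y, z) ↦ (x + y, x - y, 2z)` from presentations of `k` by `x² + y² + 2z²`
to presentations of `2k` as a sum of three squares. -/
def doubling : ℤ × ℤ × ℤ → ℤ × ℤ × ℤ := fun p => (p.1 + p.2.1, p.1 - p.2.1, 2 * p.2.2)

theorem doubling_injective : Function.Injective doubling := by
  rintro ⟨x, y, z⟩ ⟨x', y', z'⟩ h
  simp only [doubling, Prod.mk.injEq] at h ⊢
  omega

theorem doubling_image_reps112 (k : ℕ) :
    doubling '' reps112 k = {p ∈ reps3 (2 * k) | Even p.2.2} := by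
  ext ⟨x, y, z⟩
  simp only [doubling, reps112, reps3, Set.mem_image, Set.mem_ofPred_eq, Prod.exists,
    Prod.mk.injEq]
  constructor
  · rintro ⟨a, b, c, h, rfl, rfl, rfl⟩
    exact ⟨by push_cast; rw [h]; ring, even_two_mul c⟩
  · rintro ⟨h, hz⟩
    obtain ⟨c, rfl⟩ := even_iff_two_dvd.1 hz
    have hxy : Even (x + y) := by
      have : Even ((x + y) ^ 2) :=
        ⟨k - 2 * c ^ 2 + x * y, by push_cast at h; linear_combination -h⟩
      exact (Int.even_pow' two_ne_zero).1 this
    obtain ⟨a, ha⟩ := hxy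
    refine ⟨a, x - a, c, ?_, by ring, by linarith, rfl⟩
    obtain rfl : y = 2 * a - x := by linarith
    push_cast at h
    linarith

theorem finite_reps3 (n : ℕ) : (reps3 n).Finite := by
  refine ((Set.finite_Icc (-n : ℤ) n).prod
    ((Set.finite_Icc (-n : ℤ) n).prod (Set.finite_Icc (-n : ℤ) n))).subset ?_
  rintro ⟨x, y, z⟩ h
  simp only [reps3, Set.mem_ofPred_eq] at h
  have hb : ∀ t : ℤ, t ^ 2 ≤ n → -n ≤ t ∧ t ≤ n := fun t ht => by
    have := Int.le_self_sq t
    have := Int.le_self_sq (-t)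
    rw [neg_sq] at this
    constructor <;> linarith
  simp only [Set.mem_prod, Set.mem_Icc]
  have := sq_nonneg x
  have := sq_nonneg y
  have := sq_nonneg z
  exact ⟨hb x (by linarith), hb y (by linarith), hb z (by linarith)⟩

theorem finite_reps112 (k : ℕ) : (reps112 k).Finite := by
  refine Set.Finite.of_finite_image ?_ doubling_injective.injOn
  rw [doubling_image_reps112]
  exact (finite_reps3 _).subset (Set.sep_subset _ _)

theorem N112_eq_ncard (k : ℕ) : N112 k = {p ∈ reps3 (2 * k) | Even p.2.2}.ncard := by
  rw [N112, ← doubling_image_reps112, Set.ncard_image_of_injective _ doubling_injective]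

theorem Int.sq_emod_four (t : ℤ) : Even t ∧ t ^ 2 % 4 = 0 ∨ ¬ Even t ∧ t ^ 2 % 4 = 1 := by
  rcases Int.even_or_odd t with h | h
  · obtain ⟨s, rfl⟩ := h
    exact .inl ⟨⟨s, rfl⟩, by ring_nf; omega⟩
  · refine .inr ⟨Int.not_even_iff_odd.2 h, ?_⟩
    obtain ⟨s, rfl⟩ := h
    ring_nf
    omega

theorem N112_eq_N3_of_even {k : ℕ} (hk : Even k) : N112 k = N3 (2 * k) := by
  rw [N112_eq_ncard, N3]
  congr 1
  refine Set.sep_eq_self_iff_mem_true.2 ?_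
  rintro ⟨x, y, z⟩ h
  simp only [reps3, Set.mem_ofPred_eq] at h
  obtain ⟨t, rfl⟩ := hk
  have hx := Int.sq_emod_four x
  have hy := Int.sq_emod_four y
  have hz := Int.sq_emod_four z
  push_cast at h
  rcases hz with hz | hz
  · exact hz.1
  · omega

theorem N3_eq_three_mul_N112_of_odd {k : ℕ} (hk : Odd k) : N3 (2 * k) = 3 * N112 k := by
  let S (P : ℤ × ℤ × ℤ → Prop) : Set (ℤ × ℤ × ℤ) := {p ∈ reps3 (2 * k) | P p}
  have hfin : ∀ P, (S P).Finite := fun P => (finite_reps3 _).subset (Set.sep_subset _ _)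
  have hone : ∀ x y z : ℤ, (x, y, z) ∈ reps3 (2 * k) →
      (Even x ∧ ¬ Even y ∧ ¬ Even z) ∨ (¬ Even x ∧ Even y ∧ ¬ Even z) ∨
        (¬ Even x ∧ ¬ Even y ∧ Even z) := by
    intro x y z h
    simp only [reps3, Set.mem_ofPred_eq] at h
    obtain ⟨t, rfl⟩ := hk
    push_cast at h
    rcases Int.sq_emod_four x with hx | hx <;> rcases Int.sq_emod_four y with hy | hy <;>
      rcases Int.sq_emod_four z with hz | hz <;>
      first | (exfalso; omega) | simp [hx.1, hy.1, hz.1]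
  have hunion : reps3 (2 * k) =
      S (fun p => Even p.1) ∪ (S (fun p => Even p.2.1) ∪ S (fun p => Even p.2.2)) := by
    ext ⟨x, y, z⟩
    have := hone x y z
    simp only [S, Set.mem_union, Set.mem_ofPred_eq]
    tauto
  have hd₁ : Disjoint (S fun p => Even p.2.1) (S fun p => Even p.2.2) := by
    rw [Set.disjoint_left]
    rintro ⟨x, y, z⟩ h₁ h₂
    have := hone x y z h₁.1
    have h₃ : Even y := h₁.2
    have h₄ : Even z := h₂.2
    tauto
  have hd₂ : Disjoint (S fun p => Even p.1)
      (S (fun p => Even p.2.1) ∪ S (fun p => Even p.2.2)) := by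
    rw [Set.disjoint_left]
    rintro ⟨x, y, z⟩ h₁ h₂
    have := hone x y z h₁.1
    have h₃ : Even x := h₁.2
    have h₄ : Even y ∨ Even z := h₂.imp And.right And.right
    tauto
  have he₁ : (S fun p => Even p.1).ncard = (S fun p => Even p.2.2).ncard := by
    refine Set.ncard_congr (fun p _ => (p.2.2, p.2.1, p.1)) ?_ ?_ ?_
    · rintro ⟨x, y, z⟩ ⟨h, he⟩
      simp only [S, reps3, Set.mem_ofPred_eq] at h he ⊢
      exact ⟨by rw [h]; ring, he⟩
    · rintro ⟨x, y, z⟩ ⟨x', y', z'⟩ _ _ h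
      simp only [Prod.mk.injEq] at h ⊢
      tauto
    · rintro ⟨x, y, z⟩ ⟨h, he⟩
      simp only [reps3, Set.mem_ofPred_eq] at h he
      exact ⟨(z, y, x), ⟨by simp only [reps3, Set.mem_ofPred_eq]; rw [h]; ring, he⟩, rfl⟩
  have he₂ : (S fun p => Even p.2.1).ncard = (S fun p => Even p.2.2).ncard := by
    refine Set.ncard_congr (fun p _ => (p.1, p.2.2, p.2.1)) ?_ ?_ ?_
    · rintro ⟨x, y, z⟩ ⟨h, he⟩
      simp only [S, reps3, Set.mem_ofPred_eq] at h he ⊢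
      exact ⟨by rw [h]; ring, he⟩
    · rintro ⟨x, y, z⟩ ⟨x', y', z'⟩ _ _ h
      simp only [Prod.mk.injEq] at h ⊢
      tauto
    · rintro ⟨x, y, z⟩ ⟨h, he⟩
      simp only [reps3, Set.mem_ofPred_eq] at h he
      exact ⟨(x, z, y), ⟨by simp only [reps3, Set.mem_ofPred_eq]; rw [h]; ring, he⟩, rfl⟩
  rw [N112_eq_ncard, N3]
  conv_lhs => rw [hunion]
  rw [Set.ncard_union_eq hd₂ (hfin _) ((hfin _).union (hfin _)),
    Set.ncard_union_eq hd₁ (hfin _) (hfin _), he₁, he₂]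
  simp only [S]
  ring

theorem exists_eq_sq_add_sq_add_two_sq_iff (k : ℕ) :
    (∃ x y z : ℤ, (k : ℤ) = x ^ 2 + y ^ 2 + 2 * z ^ 2) ↔
      ∃ x y z : ℤ, ((2 * k : ℕ) : ℤ) = x ^ 2 + y ^ 2 + z ^ 2 := by
  constructor
  · rintro ⟨x, y, z, h⟩
    exact ⟨x + y, x - y, 2 * z, by push_cast; rw [h]; ring⟩
  · have key : ∀ x y z : ℤ, ((2 * k : ℕ) : ℤ) = x ^ 2 + y ^ 2 + z ^ 2 → Even z →
        ∃ x y z : ℤ, (k : ℤ) = x ^ 2 + y ^ 2 + 2 * z ^ 2 := by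
      intro x y z h hz
      have hmem : (x, y, z) ∈ doubling '' reps112 k := by
        rw [doubling_image_reps112]
        exact ⟨h, hz⟩
      obtain ⟨⟨a, b, c⟩, hp, -⟩ := hmem
      exact ⟨a, b, c, hp⟩
    rintro ⟨x, y, z, h⟩
    by_cases hz : Even z
    · exact key x y z h hz
    by_cases hy : Even y
    · exact key x z y (by rw [h]; ring) hy
    -- With `y` and `z` odd, `x² = 2k - y² - z²` is even.
    refine key z y x (by rw [h]; ring) ?_
    have hx := Int.sq_emod_four x
    have hy' := Int.sq_emod_four y
    have hz' := Int.sq_emod_four z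
    push_cast at h
    rcases hx with hx | hx
    · exact hx.1
    · have := hy'.resolve_left fun h => hy h.1
      have := hz'.resolve_left fun h => hz h.1
      omega

theorem theorem12 (k : ℕ) :
    ((∃ x y z : ℤ, (k : ℤ) = x ^ 2 + y ^ 2 + 2 * z ^ 2) ↔
      ¬ ∃ m l : ℕ, 2 * k = 4 ^ m * (8 * l + 7)) ∧
    (reps112 k).Finite ∧ (reps3 (2 * k)).Finite ∧
    (Even k → N112 k = N3 (2 * k)) ∧
    (Odd k → (N112 k : ℚ) = (N3 (2 * k) : ℚ) / 3) := by
  refine ⟨?_, finite_reps112 k, finite_reps3 _, N112_eq_N3_of_even, fun hk => ?_⟩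
  · rw [exists_eq_sq_add_sq_add_two_sq_iff, sum_three_sq_iff]
  · rw [N3_eq_three_mul_N112_of_odd hk]
    push_cast
    ring
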